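/- **Setting.** Let $n\ge 0$ and $t\ge 1$ be integers. Let $\Theta$ be a finite nonempty set and $\mathfrak F=\{f_\theta:\{0,1\}^n\to\{0,1\}\}_{\theta\in\Theta}$ a $(4t+2)$-wise uniform family: for uniform $\theta\in\Theta$ and any set $S$ of at most $4t+2$ distinct points of $\{0,1\}^n$, the restriction $f_\theta|_S$ is uniformly distributed on $\{0,1\}^S$. Put $$U_\theta=\mathsf U_{f_\theta}\mathsf H^{\otimes n},\qquad U_\theta|x\rangle=2^{-n/2}\sum_{u\in\{0,1\}^n}(-1)^{f_\theta(u)\oplus\langle x,u\rangle}|u\rangle .$$ **Game.** In the $t\mapsto t+1$ oracular cloning game $\mathsf G_{\mathfrak F,t}$, $\theta\in\Theta$ and $x\in\{0,1\}^n$ are drawn uniformly and independently. A cloner receives $(U_\theta|x\rangle)^{\otimes t}$, applies an arbitrary quantum channel (completely positive trace-preserving map) $\Phi$ and sends the resulting finite-dimensional registers $B_1,\dots,B_{t+1}$ to $t+1$ players, who do not communicate. The players win if all of them output $x$. **Restricted strategies.** A restricted strategy $\mathsf S$ consists of such a channel $\Phi$ and, for each player, a quantum algorithm that makes at most one query to $U_\theta$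 or $U_\theta^\dagger$ and depends on $\theta$ only through this query. That is, the player applies to the register $B_i$ a quantum instrument (independent of $\theta$) with output an $n$-qubit query register and a workspace of arbitrary finite dimension (any number of ancilla qubits); depending on the classical outcome of the instrument, $U_\theta$, $U_\theta^\dagger$ or nothing is applied to the query register; then the player makes a measurement (a POVM independent of $\theta$, which may depend on that outcome) on both registers, with result in $\{0,1\}^n$. If $\mathbf P_{i,x}^{U_\theta,U_\theta^\dagger}$ is the resulting measurement operator on $B_i$ for the output $x$ of player $i$, the winning probability is $$\omega_{\mathsf S}(\mathsf G_{\mathfrak F,t})=\mathop{\mathbb E}_{\theta}\mathop{\mathbb E}_{x}\operatorname{Tr}\Big[\big(\mathbf P_{1,x}^{U_\theta,U_\theta^\dagger}\otimes\cdots\otimes\mathbf P_{t+1,x}^{U_\theta,U_\theta^\dagger}\big)\,\Phi\big((U_\theta|x\rangle\langle x|U_\theta^\dagger)^{\otimes t}\big)\Big].$$ **Theorem.** There is an absolute constant $C>0$ such that for all $t\ge1$, all $n$, all $(4t+2)$-wise uniform families $\mathfrak F$ as above and all restricted strategies $\mathsf S$, $$\omega_{\mathsf S}(\mathsf G_{\mathfrak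 F,t})\le \exp\big(C\,t\log(t+1)\big)\cdot 2^{-n}.$$ The constant $C$ does not depend on the number of ancilla qubits; in particular, for constant $t$ the supremum over all restricted strategies is $O(2^{-n})$. -/

import Mathlib

open scoped Matrix Kronecker ComplexOrder

namespace CloningGame

/-- The set `{0,1}^n`; it indexes the computational basis of `n` qubits. -/
abbrev Bits (n : ℕ) : Type := Fin n → Bool

/-- The sign `(-1)^b` of a bit `b`. -/
def sign (b : Bool) : ℂ := (-1) ^ b.toNat

/-- The sign `(-1)^⟨x, y⟩`, where `⟨x, y⟩ = ∑ᵢ xᵢ yᵢ`. -/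
def innerSign {n : ℕ} (x y : Bits n) : ℂ := (-1) ^ ∑ i, (x i && y i).toNat

/-- The phase oracle `U_f = ∑ₓ (-1)^{f(x)} |x⟩⟨x|`. -/
def phaseOracle {n : ℕ} (f : Bits n → Bool) : Matrix (Bits n) (Bits n) ℂ :=
  Matrix.diagonal fun x => sign (f x)

/-- The `n`-qubit Hadamard operator `H^{⊗n} = 2^{-n/2} ∑_{x,y} (-1)^{⟨x,y⟩} |x⟩⟨y|`. -/
noncomputable def hadamard (n : ℕ) : Matrix (Bits n) (Bits n) ℂ :=
  Matrix.of fun x y => ((Real.sqrt 2 : ℝ) : ℂ)⁻¹ ^ n * innerSign x y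

theorem phaseOracle_mem {n : ℕ} (f : Bits n → Bool) :
    phaseOracle f ∈ Matrix.unitaryGroup (Bits n) ℂ := by
  rw [Matrix.mem_unitaryGroup_iff, phaseOracle, Matrix.star_eq_conjTranspose,
    Matrix.diagonal_conjTranspose, Matrix.diagonal_mul_diagonal, ← Matrix.diagonal_one]
  congr 1
  funext x
  cases h : f x <;> simp [sign, h]

theorem sum_innerSign {n : ℕ} (x z : Bits n) :
    ∑ y, innerSign x y * innerSign z y = if x = z then (2 : ℂ) ^ n else 0 := by
  have h1 : ∀ y : Bits n, innerSign x y * innerSign z y =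
      ∏ i, ((-1 : ℂ) ^ (x i && y i).toNat * (-1) ^ (z i && y i).toNat) := by
    intro y
    rw [innerSign, innerSign, Finset.prod_mul_distrib, Finset.prod_pow_eq_pow_sum,
      Finset.prod_pow_eq_pow_sum]
  have h2 : ∀ a c : Bool, (∑ b : Bool, ((-1 : ℂ) ^ (a && b).toNat * (-1) ^ (c && b).toNat)) =
      if a = c then 2 else 0 := by
    intro a c
    cases a <;> cases c <;> norm_num
  simp_rw [h1]
  have h3 := (Finset.prod_univ_sum (fun _ : Fin n => (Finset.univ : Finset Bool))
    (fun i b => ((-1 : ℂ) ^ (x i && b).toNat * (-1) ^ (z i && b).toNat)))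
  rw [Fintype.piFinset_univ] at h3
  rw [← h3]
  simp_rw [h2]
  split_ifs with h
  · subst h
    simp
  · obtain ⟨i, hi⟩ := Function.ne_iff.mp h
    exact Finset.prod_eq_zero (Finset.mem_univ i) (by simp [hi])

theorem hadamard_mem (n : ℕ) : hadamard n ∈ Matrix.unitaryGroup (Bits n) ℂ := by
  rw [Matrix.mem_unitaryGroup_iff, Matrix.star_eq_conjTranspose]
  ext x z
  have hs : ∀ u v : Bits n, star (innerSign u v) = innerSign u v := by
    intro u v
    simp [innerSign]
  have h2 : (((Real.sqrt 2 : ℝ) : ℂ)⁻¹ ^ n) * (((Real.sqrt 2 : ℝ) : ℂ)⁻¹ ^ n) * 2 ^ n = 1 := by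
    rw [← mul_pow, ← mul_pow, ← mul_inv, ← Complex.ofReal_mul,
      Real.mul_self_sqrt (by norm_num)]
    norm_num
  have hc : star (((Real.sqrt 2 : ℝ) : ℂ)⁻¹ ^ n) = ((Real.sqrt 2 : ℝ) : ℂ)⁻¹ ^ n := by
    simp
  have h3 : (hadamard n * (hadamard n)ᴴ) x z =
      (((Real.sqrt 2 : ℝ) : ℂ)⁻¹ ^ n) * (((Real.sqrt 2 : ℝ) : ℂ)⁻¹ ^ n) *
        ∑ y, innerSign x y * innerSign z y := by
    rw [Matrix.mul_apply, Finset.mul_sum]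
    refine Finset.sum_congr rfl fun y _ => ?_
    rw [Matrix.conjTranspose_apply]
    simp only [hadamard, Matrix.of_apply, star_mul', hs, hc]
    ring
  rw [h3, sum_innerSign, Matrix.one_apply]
  split_ifs
  · exact h2
  · simp

/-- The unitary `U_f H^{⊗n}`; it maps `|x⟩` to `2^{-n/2} ∑ᵤ (-1)^{f(u) ⊕ ⟨x,u⟩} |u⟩`. -/
noncomputable def binaryPhaseUnitary {n : ℕ} (f : Bits n → Bool) :
    Matrix.unitaryGroup (Bits n) ℂ :=
  ⟨phaseOracle f, phaseOracle_mem f⟩ * ⟨hadamard n, hadamard_mem n⟩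

/-- `f_θ`, for `θ` uniform in `Θ`, is a `k`-wise uniform family of functions `X → {0,1}`: on any
set of at most `k` distinct points, the values of `f_θ` are independent uniform bits. (If
`k ≤ |X|`, it is the same to ask this for sets of exactly `k` points.) -/
def IsWiseUniform {Θ X : Type*} [Fintype Θ] (k : ℕ) (f : Θ → X → Bool) : Prop :=
  ∀ S : Finset X, S.card ≤ k → ∀ g : X → Bool,
    Nat.card {θ : Θ // ∀ x ∈ S, f θ x = g x} * 2 ^ S.card = Fintype.card Θ

/-- The tensor product `⨂ᵢ Mᵢ` of a finite family of operators. -/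
def tensor {ι : Type*} [Fintype ι] {α : ι → Type*} (M : (i : ι) → Matrix (α i) (α i) ℂ) :
    Matrix ((i : ι) → α i) ((i : ι) → α i) ℂ :=
  Matrix.of fun a b => ∏ i, M i (a i) (b i)

/-- The induced map `id_R ⊗ Φ`, for a reference system `R` of dimension `k`. -/
def ampliation {α β : Type*} (Φ : Matrix α α ℂ →ₗ[ℂ] Matrix β β ℂ) (k : ℕ)
    (X : Matrix (Fin k × α) (Fin k × α) ℂ) : Matrix (Fin k × β) (Fin k × β) ℂ :=
  Matrix.of fun p q => Φ (Matrix.of fun a b => X (p.1, a) (q.1, b)) p.2 q.2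

/-- Completely positive and trace-preserving linear maps (quantum channels). -/
structure IsCPTP {α β : Type*} [Fintype α] [Fintype β]
    (Φ : Matrix α α ℂ →ₗ[ℂ] Matrix β β ℂ) : Prop where
  completelyPositive : ∀ (k : ℕ) (X : Matrix (Fin k × α) (Fin k × α) ℂ),
    X.PosSemidef → (ampliation Φ k X).PosSemidef
  tracePreserving : ∀ X : Matrix α α ℂ, (Φ X).trace = X.trace

/-- Positive-operator valued measures with outcomes in `O`. -/
structure IsPOVM {O α : Type*} [Fintype O] [Fintype α] [DecidableEq α]
    (M : O → Matrix α α ℂ) : Prop where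
  posSemidef : ∀ x, (M x).PosSemidef
  sum_eq_one : ∑ x, M x = 1

/-- What a player may do with their only oracle query: not use it, or apply the oracle unitary, or
apply its inverse. -/
inductive Query
  | none
  | forward
  | inverse

/-- The operator that is applied to the query register. -/
def Query.op {n : ℕ} (U : Matrix.unitaryGroup (Bits n) ℂ) :
    Query → Matrix (Bits n) (Bits n) ℂ
  | .none => 1
  | .forward => (U : Matrix (Bits n) (Bits n) ℂ)
  | .inverse => (U : Matrix (Bits n) (Bits n) ℂ)ᴴ

/-- A quantum algorithm on a `d`-dimensional register that makes at most one query to `U` or `U†`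
and outputs an element of `{0,1}^n`. -/
structure OneQueryAlgorithm (n d : ℕ) where
  /-- The dimension of the workspace that is kept next to the `n`-qubit query register. -/
  ancillaDim : ℕ
  /-- The number of outcomes of the quantum instrument applied before the query. -/
  numOutcomes : ℕ
  /-- The Kraus operators of that instrument, one for each classical outcome; they map the
  player's register to the query register and the workspace. -/
  kraus : Fin numOutcomes → Matrix (Bits n × Fin ancillaDim) (Fin d) ℂ
  kraus_complete : ∑ k, (kraus k)ᴴ * kraus k = 1
  /-- The query that is made, given the classical outcome. -/
  query : Fin numOutcomes → Query
  /-- The measurement after the query, whose outcome is the player's guess. -/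
  measure : Fin numOutcomes → Bits n →
    Matrix (Bits n × Fin ancillaDim) (Bits n × Fin ancillaDim) ℂ
  isPOVM_measure : ∀ k, IsPOVM (measure k)

/-- The measurement operator `P_x^{U,U†}` on the player's register: its expectation in a state is
the probability that the algorithm outputs `x` when it is run on that state with oracle `U`. -/
def OneQueryAlgorithm.effect {n d : ℕ} (A : OneQueryAlgorithm n d)
    (U : Matrix.unitaryGroup (Bits n) ℂ) (x : Bits n) : Matrix (Fin d) (Fin d) ℂ :=
  ∑ k, ((((A.query k).op U) ⊗ₖ (1 : Matrix (Fin A.ancillaDim) (Fin A.ancillaDim) ℂ)) *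
        A.kraus k)ᴴ *
      A.measure k x *
      ((((A.query k).op U) ⊗ₖ (1 : Matrix (Fin A.ancillaDim) (Fin A.ancillaDim) ℂ)) * A.kraus k)

/-- A restricted strategy in a `t ↦ t + 1` oracular cloning game on `n` qubits: the cloner applies
an arbitrary channel to the `t` copies, and each of the `t + 1` players makes at most one query. -/
structure RestrictedStrategy (n t : ℕ) where
  /-- The dimensions of the registers of the players. -/
  dim : Fin (t + 1) → ℕ
  /-- The cloning channel. -/
  channel : Matrix (Fin t → Bits n) (Fin t → Bits n) ℂ →ₗ[ℂ]
    Matrix ((i : Fin (t + 1)) → Fin (dim i)) ((i : Fin (t + 1)) → Fin (dim i)) ℂ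
  isCPTP_channel : IsCPTP channel
  player : (i : Fin (t + 1)) → OneQueryAlgorithm n (dim i)

/-- The state `U |x⟩⟨x| U†`. -/
def cipherState {n : ℕ} (U : Matrix.unitaryGroup (Bits n) ℂ) (x : Bits n) :
    Matrix (Bits n) (Bits n) ℂ :=
  (U : Matrix (Bits n) (Bits n) ℂ) * Matrix.single x x 1 * (U : Matrix (Bits n) (Bits n) ℂ)ᴴ

/-- The probability that all players of the strategy `S` output `x`, in the game with unitary `U`
and answer `x`. (This trace is a real number.) -/
noncomputable def winProbAt {n t : ℕ} (U : Matrix.unitaryGroup (Bits n) ℂ)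
    (S : RestrictedStrategy n t) (x : Bits n) : ℝ :=
  (tensor (fun i => (S.player i).effect U x) *
    S.channel (tensor fun _ : Fin t => cipherState U x)).trace.re

/-- The winning probability `ω_S(G)` of the strategy `S` in the `t ↦ t + 1` oracular cloning game
with unitaries `U_θ`: `θ ∈ Θ` and `x ∈ {0,1}^n` are uniform and independent. -/
noncomputable def winProb {n t : ℕ} {Θ : Type*} [Fintype Θ]
    (U : Θ → Matrix.unitaryGroup (Bits n) ℂ) (S : RestrictedStrategy n t) : ℝ :=
  (Fintype.card Θ : ℝ)⁻¹ * ∑ θ, ((Fintype.card (Bits n) : ℝ)⁻¹ * ∑ x, winProbAt (U θ) S x)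

end CloningGame

/-! Up to fixed unitaries, a query to `U_θ` or its inverse is a query to the phase oracle of `f_θ`.
Player `i` thus contributes one sign $(-1)^{f(l_i(a_i))}$, where $a_i$ is a basis state of the
register and $l_i(a_i)$ the queried point; the $t$ copies contribute the signs
$(-1)^{f(u_s)\oplus\langle x,u_s\rangle}$. The sign in $f$ of a term $(a,u)$ is the character of the
set $T$ of points that occur an odd number of times among the $2t+1$ points $l_i(a_i)$, $u_s$. Since
$|T|\le 2t+1$, $(4t+2)$-wise uniformity removes the interference between different $T$
(`IsWiseUniform.sum_expectation`).

For fixed $T$, the sign $\prod_s(-1)^{\langle x,u_s\rangle}$ equals $\prod_i(-1)^{\langle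
x,l_i(a_i)\rangle}$ up to a global sign (`phaseState_eq_sum`), so $x$ enters only through local
signs on the players' registers. There are more players than copies: by pigeonhole some $l_i(a_i)$
lies in $T$ or equals another $l_k(a_k)$ (`exists_mem_oddSupport_or_eq`). Once $i$ and that point of
$T$, or $i$ and $k$, are fixed, the sign no longer depends on $a_i$. The reduced state of player $i$
is then independent of $x$, and the success weights sum over $x$ to at most the squared norm.

Cauchy–Schwarz over at most $(t+1)(3t+2)$ such pieces (`sum_expectation_tensor_innerSign_le`) gives
the bound $(t+1)(3t+2)\,2^{-n}$. It is polynomial in $t$, and no ancilla dimension enters. -/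

namespace CloningGame

/-! ### Positive semidefinite operators and expectations -/

section PosSemidef

variable {α : Type*} [Fintype α]

theorem exists_eq_conjTranspose_mul_self {M : Matrix α α ℂ} (hM : M.PosSemidef) :
    ∃ B : Matrix α α ℂ, M = Bᴴ * B := by
  classical
  open scoped MatrixOrder in
  exact CStarAlgebra.nonneg_iff_eq_star_mul_self.mp hM.nonneg

theorem posSemidef_blockDiagonal {o : Type*} [Fintype o] [DecidableEq o]
    {M : o → Matrix α α ℂ} (hM : ∀ k, (M k).PosSemidef) :
    (Matrix.blockDiagonal M).PosSemidef := by
  choose B hB using fun k => exists_eq_conjTranspose_mul_self (hM k)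
  have h : Matrix.blockDiagonal M = (Matrix.blockDiagonal B)ᴴ * Matrix.blockDiagonal B := by
    rw [Matrix.blockDiagonal_conjTranspose, ← Matrix.blockDiagonal_mul]
    exact congrArg _ (funext hB)
  rw [h]
  exact Matrix.posSemidef_conjTranspose_mul_self _

/-- The expectation `⟨v|M|v⟩` of an operator in a (not necessarily normalized) vector. -/
noncomputable def expectation (M : Matrix α α ℂ) (v : α → ℂ) : ℝ :=
  (star v ⬝ᵥ M *ᵥ v).re

theorem expectation_eq_sum (M : Matrix α α ℂ) (v : α → ℂ) :
    expectation M v = (∑ a, ∑ b, star (v a) * M a b * v b).re := by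
  simp [expectation, dotProduct, Matrix.mulVec, Finset.mul_sum, mul_assoc]

theorem expectation_nonneg {M : Matrix α α ℂ} (hM : M.PosSemidef) (v : α → ℂ) :
    0 ≤ expectation M v :=
  (Complex.le_def.mp (hM.dotProduct_mulVec_nonneg v)).1

theorem expectation_sum {κ : Type*} (s : Finset κ) (M : κ → Matrix α α ℂ) (v : α → ℂ) :
    expectation (∑ k ∈ s, M k) v = ∑ k ∈ s, expectation (M k) v := by
  simp [expectation, Matrix.sum_mulVec, dotProduct_sum]

theorem expectation_conjTranspose_mul_mul {β : Type*} [Fintype β] (M : Matrix β β ℂ)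
    (V : Matrix β α ℂ) (v : α → ℂ) : expectation (Vᴴ * M * V) v = expectation M (V *ᵥ v) := by
  simp only [expectation, ← Matrix.mulVec_mulVec, Matrix.star_mulVec, Matrix.dotProduct_mulVec,
    Matrix.vecMul_vecMul]

theorem expectation_one [DecidableEq α] (v : α → ℂ) : expectation 1 v = ∑ a, ‖v a‖ ^ 2 := by
  simp only [expectation, Matrix.one_mulVec, dotProduct, Pi.star_apply, Complex.re_sum]
  refine Finset.sum_congr rfl fun a _ => ?_
  rw [Complex.star_def, Complex.conj_mul', ← Complex.ofReal_pow, Complex.ofReal_re]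

theorem expectation_conjTranspose_mul_self {β : Type*} [Fintype β] (B : Matrix β α ℂ)
    (v : α → ℂ) : expectation (Bᴴ * B) v = ∑ c, ‖(B *ᵥ v) c‖ ^ 2 := by
  classical
  rw [← expectation_one, ← expectation_conjTranspose_mul_mul, Matrix.mul_one]

/-- The Cauchy–Schwarz inequality for the seminorm of a positive semidefinite operator. -/
theorem expectation_sum_le {R : Type*} [Fintype R] {M : Matrix α α ℂ} (hM : M.PosSemidef)
    (v : R → α → ℂ) :
    expectation M (∑ r, v r) ≤ Fintype.card R * ∑ r, expectation M (v r) := by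
  obtain ⟨B, rfl⟩ := exists_eq_conjTranspose_mul_self hM
  simp_rw [expectation_conjTranspose_mul_self]
  rw [Finset.sum_comm, Finset.mul_sum]
  refine Finset.sum_le_sum fun c _ => ?_
  have h : (B *ᵥ ∑ r, v r) c = ∑ r, (B *ᵥ v r) c := by
    simp [Matrix.mulVec, dotProduct_sum]
  rw [h]
  calc ‖∑ r, (B *ᵥ v r) c‖ ^ 2 ≤ (∑ r, ‖(B *ᵥ v r) c‖) ^ 2 := by
        gcongr
        exact norm_sum_le _ _
    _ ≤ _ := sq_sum_le_card_mul_sum_sq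

theorem trace_mul_vecMulVec (M : Matrix α α ℂ) (v : α → ℂ) :
    (M * Matrix.vecMulVec v (star v)).trace.re = expectation M v := by
  rw [Matrix.mul_vecMulVec, Matrix.trace_vecMulVec, dotProduct_comm, expectation]

end PosSemidef

/-! ### Tensor products of operators -/

section Tensor

variable {ι : Type*} [Fintype ι] {α β γ : ι → Type*}

/-- The tensor product of a finite family of (rectangular) matrices. -/
def tensorMap (M : (i : ι) → Matrix (α i) (β i) ℂ) :
    Matrix ((i : ι) → α i) ((i : ι) → β i) ℂ :=
  Matrix.of fun a b => ∏ i, M i (a i) (b i)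

theorem tensorMap_mul [DecidableEq ι] [∀ i, Fintype (β i)] (M : (i : ι) → Matrix (α i) (β i) ℂ)
    (N : (i : ι) → Matrix (β i) (γ i) ℂ) :
    tensorMap M * tensorMap N = tensorMap fun i => M i * N i := by
  ext a c
  simp only [Matrix.mul_apply, tensorMap, Matrix.of_apply, Fintype.prod_sum,
    Finset.prod_mul_distrib]

theorem tensorMap_conjTranspose (M : (i : ι) → Matrix (α i) (β i) ℂ) :
    (tensorMap M)ᴴ = tensorMap fun i => (M i)ᴴ := by
  ext a b
  simp [tensorMap, Matrix.conjTranspose_apply]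

theorem tensorMap_one [∀ i, DecidableEq (α i)] :
    tensorMap (fun i => (1 : Matrix (α i) (α i) ℂ)) = 1 := by
  classical
  ext a b
  simp [tensorMap, Matrix.one_apply, Finset.prod_ite_zero, funext_iff]

theorem posSemidef_tensor [DecidableEq ι] [∀ i, Fintype (α i)] {M : (i : ι) → Matrix (α i) (α i) ℂ}
    (hM : ∀ i, (M i).PosSemidef) : (tensor M).PosSemidef := by
  choose B hB using fun i => exists_eq_conjTranspose_mul_self (hM i)
  have h : tensor M = (tensorMap B)ᴴ * tensorMap B := by
    rw [tensorMap_conjTranspose, tensorMap_mul, funext hB]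
    rfl
  rw [h]
  exact Matrix.posSemidef_conjTranspose_mul_self _

/-- The operator `1 ⊗ M ⊗ 1` that acts as `M` on the factor `i`. -/
def onFactor [DecidableEq ι] [∀ i, DecidableEq (α i)] (i : ι) (M : Matrix (α i) (α i) ℂ) :
    Matrix ((i : ι) → α i) ((i : ι) → α i) ℂ :=
  tensor (Function.update (fun _ => 1) i M)

theorem onFactor_apply [DecidableEq ι] [∀ i, DecidableEq (α i)] (i : ι) (M : Matrix (α i) (α i) ℂ)
    (a b : (i : ι) → α i) :
    onFactor i M a b = if ∀ k, k ≠ i → a k = b k then M (a i) (b i) else 0 := by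
  rw [onFactor, tensor, Matrix.of_apply, ← Finset.mul_prod_erase _ _ (Finset.mem_univ i),
    Function.update_self]
  have h : ∏ k ∈ Finset.univ.erase i,
      Function.update (fun k => (1 : Matrix (α k) (α k) ℂ)) i M k (a k) (b k) =
      ∏ k ∈ Finset.univ.erase i, if a k = b k then (1 : ℂ) else 0 := by
    refine Finset.prod_congr rfl fun k hk => ?_
    rw [Function.update_of_ne (Finset.ne_of_mem_erase hk), Matrix.one_apply]
  rw [h, Finset.prod_ite_zero]
  simp

theorem sum_onFactor [DecidableEq ι] [∀ i, DecidableEq (α i)] {O : Type*} [Fintype O] (i : ι)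
    {M : O → Matrix (α i) (α i) ℂ} (hM : ∑ x, M x = 1) : ∑ x, onFactor i (M x) = 1 := by
  ext a b
  simp only [Matrix.sum_apply, onFactor_apply]
  have h : ∑ x, M x (a i) (b i) = (1 : Matrix (α i) (α i) ℂ) (a i) (b i) := by
    rw [← hM, Matrix.sum_apply]
  rw [Matrix.one_apply] at h
  by_cases hab : a = b
  · subst hab
    simpa using h
  · rw [Matrix.one_apply_ne hab]
    split_ifs with hk
    · rw [h, if_neg]
      intro hi
      refine hab (funext fun k => ?_)
      by_cases hki : k = i
      · exact hki ▸ hi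
      · exact hk k hki
    · simp

/-- Writing the identity on each other factor as the sum of its POVM elements expands `onFactor`
into positive terms, one of which is the tensor product on the left. -/
theorem expectation_tensor_le [DecidableEq ι] [∀ i, Fintype (α i)] [∀ i, DecidableEq (α i)]
    {O : Type*} [Fintype O] {M : (i : ι) → O → Matrix (α i) (α i) ℂ} (hM : ∀ i, IsPOVM (M i))
    (x : O) (i : ι) (v : ((i : ι) → α i) → ℂ) :
    expectation (tensor fun k => M k x) v ≤ expectation (onFactor i (M i x)) v := by
  classical
  let S : ι → Finset O := fun k => if k = i then {x} else Finset.univ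
  have h : onFactor i (M i x) = ∑ z ∈ Fintype.piFinset S, tensor fun k => M k (z k) := by
    ext a b
    simp only [onFactor, tensor, Matrix.of_apply, Matrix.sum_apply]
    rw [← Finset.prod_univ_sum S fun k z => M k z (a k) (b k)]
    refine Finset.prod_congr rfl fun k _ => ?_
    by_cases hk : k = i
    · subst hk
      simp [S]
    · rw [Function.update_of_ne hk, ← (hM k).sum_eq_one, Matrix.sum_apply]
      simp [S, hk]
  rw [h, expectation_sum]
  have hx : (fun _ => x) ∈ Fintype.piFinset S := by
    rw [Fintype.mem_piFinset]
    intro k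
    by_cases hk : k = i <;> simp [S, hk]
  exact Finset.single_le_sum (f := fun z : ι → O => expectation (tensor fun k => M k (z k)) v)
    (fun z _ => expectation_nonneg (posSemidef_tensor fun k => (hM k).posSemidef _) v) hx

end Tensor

/-! ### Multiplicities modulo 2 and the pigeonhole principle -/

section OddSupport

variable {κ X : Type*} [Fintype κ] [Fintype X] [DecidableEq X]

/-- The points that a finite family takes as value an odd number of times. -/
def oddSupport (w : κ → X) : Finset X :=
  Finset.univ.filter fun y => Odd (Finset.univ.filter fun k => w k = y).card

theorem prod_comp_eq_prod_oddSupport {R : Type*} [CommMonoid R] (w : κ → X) {g : X → R}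
    (hg : ∀ y, g y * g y = 1) : ∏ k, g (w k) = ∏ y ∈ oddSupport w, g y := by
  rw [oddSupport, Finset.prod_filter, ← Finset.prod_fiberwise Finset.univ w fun k => g (w k)]
  refine Finset.prod_congr rfl fun y _ => ?_
  rw [Finset.prod_congr rfl (g := fun _ => g y) (by simp +contextual), Finset.prod_const]
  split_ifs with h
  · obtain ⟨m, hm⟩ := h
    rw [hm, pow_succ, pow_mul, pow_two, hg, one_pow, one_mul]
  · obtain ⟨m, hm⟩ := Nat.not_odd_iff_even.mp h
    rw [hm, ← two_mul, pow_mul, pow_two, hg, one_pow]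

theorem exists_of_mem_oddSupport {w : κ → X} {y : X} (hy : y ∈ oddSupport w) : ∃ k, w k = y := by
  rw [oddSupport, Finset.mem_filter] at hy
  obtain ⟨k, hk⟩ := Finset.card_pos.mp hy.2.pos
  exact ⟨k, (Finset.mem_filter.mp hk).2⟩

theorem card_oddSupport_le (w : κ → X) : (oddSupport w).card ≤ Fintype.card κ := by
  calc (oddSupport w).card ≤ (Finset.univ.image w).card := by
        refine Finset.card_le_card fun y hy => ?_
        obtain ⟨k, hk⟩ := exists_of_mem_oddSupport hy
        exact Finset.mem_image.mpr ⟨k, Finset.mem_univ _, hk⟩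
    _ ≤ Fintype.card κ := Finset.card_image_le

/-- If there are more values `v i` than values `u s`, then some `v i` is another `v k` or is taken
an odd number of times in total. -/
theorem exists_mem_oddSupport_or_eq {ι σ : Type*} [Fintype ι] [Fintype σ] (v : ι → X) (u : σ → X)
    (h : Fintype.card σ < Fintype.card ι) :
    ∃ i, v i ∈ oddSupport (Sum.elim v u) ∨ ∃ k, k ≠ i ∧ v k = v i := by
  classical
  -- Otherwise the `v i` are distinct, and each must also occur among the `u s`, since its total
  -- multiplicity would else be 1; this injects `ι` into `σ`.
  by_contra! hc
  have hinj : Function.Injective v := fun i k hik => by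
    by_contra hne
    exact (hc k).2 i hne hik
  have hex : ∀ i, ∃ s, u s = v i := by
    intro i
    by_contra! hs
    refine (hc i).1 ?_
    rw [oddSupport, Finset.mem_filter]
    refine ⟨Finset.mem_univ _, ?_⟩
    have : (Finset.univ.filter fun k => Sum.elim v u k = v i) = {Sum.inl i} := by
      ext k
      rcases k with k | s
      · simp [hinj.eq_iff]
      · simp [hs s]
    rw [this]
    simp
  choose s hs using hex
  have : Function.Injective s := fun i k hik => hinj (by rw [← hs i, ← hs k, hik])
  exact absurd (Fintype.card_le_of_injective s this) (not_le.mpr h)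

end OddSupport

theorem sign_mul_self (b : Bool) : sign b * sign b = 1 := by cases b <;> simp [sign]

theorem star_sign (b : Bool) : star (sign b) = sign b := by simp [sign]

theorem innerSign_mul_self {n : ℕ} (x y : Bits n) : innerSign x y * innerSign x y = 1 := by
  rw [innerSign, ← mul_pow]
  simp

theorem star_innerSign {n : ℕ} (x y : Bits n) : star (innerSign x y) = innerSign x y := by
  simp [innerSign]

theorem innerSign_comm {n : ℕ} (x y : Bits n) : innerSign x y = innerSign y x := by
  simp [innerSign, Bool.and_comm]

/-! ### Characters and averages over wise uniform families -/

section WiseUniform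

variable {Θ X : Type*} [Fintype Θ] {m : ℕ} {f : Θ → X → Bool}

/-- The character `∏_{y ∈ T} (-1)^{f(y)}` of a Boolean function. -/
def walsh (T : Finset X) (f : X → Bool) : ℂ := ∏ y ∈ T, sign (f y)

/-- The restriction to `T` is uniform, so the sum factorizes over the points of `T`, and each factor
`1 + (-1)` vanishes. -/
theorem IsWiseUniform.sum_walsh (hf : IsWiseUniform m f) {T : Finset X} (hT : T.Nonempty)
    (hcard : T.card ≤ m) : ∑ θ, walsh T (f θ) = 0 := by
  classical
  have h1 : ∀ g : T → Bool,
      ∑ θ with (fun y : T => f θ y) = g, walsh T (f θ) =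
        ((Fintype.card Θ : ℂ) / 2 ^ T.card) * ∏ y, sign (g y) := by
    intro g
    let g' : X → Bool := fun y => if hy : y ∈ T then g ⟨y, hy⟩ else false
    have hg' : ∀ y : T, g' y = g y := fun y => by simp [g']
    have hc := hf T hcard g'
    rw [Nat.card_eq_fintype_card, Fintype.card_subtype] at hc
    have hset : (Finset.univ.filter fun θ => ∀ x ∈ T, f θ x = g' x) =
        Finset.univ.filter fun θ => (fun y : T => f θ y) = g := by
      ext θ
      simp only [Finset.mem_filter, Finset.mem_univ, true_and, funext_iff, Subtype.forall]
      refine forall₂_congr fun y hy => ?_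
      rw [← hg' ⟨y, hy⟩]
    rw [hset] at hc
    rw [Finset.sum_congr rfl (g := fun _ => ∏ y, sign (g y)), Finset.sum_const, nsmul_eq_mul,
      ← hc]
    · push_cast
      field_simp
    · intro θ hθ
      rw [Finset.mem_filter] at hθ
      rw [walsh, ← hθ.2, Finset.prod_coe_sort T fun y => sign (f θ y)]
  rw [← Finset.sum_fiberwise Finset.univ fun θ (y : T) => f θ y]
  simp_rw [h1]
  rw [← Finset.mul_sum, ← Fintype.prod_sum fun (_ : T) b => sign b]
  obtain ⟨y, hy⟩ := hT
  rw [Finset.prod_eq_zero (Finset.mem_univ (⟨y, hy⟩ : T)) (by simp [sign]), mul_zero]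

theorem walsh_mul_walsh [DecidableEq X] (S T : Finset X) (f : X → Bool) :
    walsh S f * walsh T f = walsh (symmDiff S T) f := by
  have h1 : walsh (S ∩ T) f * walsh (S ∩ T) f = 1 := by
    rw [walsh, ← Finset.prod_mul_distrib]
    exact Finset.prod_eq_one fun y _ => sign_mul_self _
  have hS : walsh S f = walsh (S \ T) f * walsh (S ∩ T) f := by
    rw [walsh, walsh, walsh, ← Finset.prod_union (Finset.disjoint_sdiff_inter S T),
      Finset.sdiff_union_inter]
  have hT : walsh T f = walsh (T \ S) f * walsh (S ∩ T) f := by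
    rw [Finset.inter_comm, walsh, walsh, walsh,
      ← Finset.prod_union (Finset.disjoint_sdiff_inter T S), Finset.sdiff_union_inter]
  have hST : walsh (symmDiff S T) f = walsh (S \ T) f * walsh (T \ S) f := by
    rw [walsh, walsh, walsh, ← Finset.prod_union disjoint_sdiff_sdiff]
    rfl
  rw [hS, hT, hST]
  linear_combination walsh (S \ T) f * walsh (T \ S) f * h1

/-- Common points cancel, which leaves the character of the symmetric difference; it is nonempty for
`S ≠ T` and has at most `S.card + T.card` points. -/
theorem IsWiseUniform.sum_walsh_mul_walsh [DecidableEq X] (hf : IsWiseUniform m f)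
    {S T : Finset X} (hcard : S.card + T.card ≤ m) :
    ∑ θ, walsh S (f θ) * walsh T (f θ) = if S = T then (Fintype.card Θ : ℂ) else 0 := by
  simp_rw [walsh_mul_walsh]
  split_ifs with h
  · subst h
    simp [walsh]
  · refine hf.sum_walsh ?_ ?_
    · rw [Finset.nonempty_iff_ne_empty]
      intro h0
      exact h (symmDiff_eq_bot.mp h0)
    · exact (Finset.card_le_card (symmDiff_le_sup (a := S) (b := T))).trans
        ((Finset.card_union_le S T).trans hcard)

theorem star_walsh (T : Finset X) (f : X → Bool) : star (walsh T f) = walsh T f := by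
  rw [walsh, star_prod]
  exact Finset.prod_congr rfl fun y _ => star_sign _

/-- Averaging over a wise uniform family removes the interference between different characters. -/
theorem IsWiseUniform.sum_expectation [Fintype X] [DecidableEq X] (hf : IsWiseUniform (2 * m) f)
    {α : Type*} [Fintype α] (M : Matrix α α ℂ) (v : Finset X → α → ℂ)
    (hv : ∀ T, m < T.card → v T = 0) :
    ∑ θ, expectation M (∑ T, walsh T (f θ) • v T) =
      Fintype.card Θ * ∑ T, expectation M (v T) := by
  have h1 : ∀ θ, star (∑ T, walsh T (f θ) • v T) ⬝ᵥ M *ᵥ (∑ T, walsh T (f θ) • v T) =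
      ∑ S, ∑ T, (walsh S (f θ) * walsh T (f θ)) * (star (v S) ⬝ᵥ M *ᵥ v T) := by
    intro θ
    simp only [star_sum, star_smul, star_walsh, Matrix.mulVec_sum, Matrix.mulVec_smul,
      sum_dotProduct, dotProduct_sum, smul_dotProduct, dotProduct_smul, smul_eq_mul]
    simp only [Finset.mul_sum]
    rw [Finset.sum_comm]
    exact Finset.sum_congr rfl fun S _ => Finset.sum_congr rfl fun T _ => by ring
  simp only [expectation, ← Complex.re_sum, h1]
  have h2 : ∀ S T, ∑ θ, (walsh S (f θ) * walsh T (f θ)) * (star (v S) ⬝ᵥ M *ᵥ v T) =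
      if S = T then (Fintype.card Θ : ℂ) * (star (v S) ⬝ᵥ M *ᵥ v S) else 0 := by
    intro S T
    by_cases hS : m < S.card
    · simp [hv S hS]
    by_cases hT : m < T.card
    · simp only [hv T hT, Matrix.mulVec_zero, dotProduct_zero, mul_zero, Finset.sum_const_zero]
      split_ifs with h
      · simp [h, hv T hT]
      · rfl
    rw [← Finset.sum_mul, hf.sum_walsh_mul_walsh (by omega)]
    split_ifs with h
    · rw [h]
    · rw [zero_mul]
  rw [Finset.sum_comm]
  simp_rw [Finset.sum_comm (s := (Finset.univ : Finset Θ)), h2]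
  simp only [Finset.sum_ite_eq, Finset.mem_univ, if_true, ← Finset.mul_sum]
  rw [← Complex.ofReal_natCast, Complex.re_ofReal_mul]

end WiseUniform

theorem expectation_smul {α : Type*} [Fintype α] (M : Matrix α α ℂ) {c : ℂ} (hc : star c * c = 1)
    (v : α → ℂ) : expectation M (c • v) = expectation M v := by
  rw [expectation, star_smul, Matrix.mulVec_smul, smul_dotProduct, dotProduct_smul, smul_smul, hc,
    one_smul, expectation]

/-! ### Players who measure after a phase query -/

section Players

variable {ι : Type*} [Fintype ι] [DecidableEq ι] {α : ι → Type*} [∀ i, Fintype (α i)]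
  [∀ i, DecidableEq (α i)] {n : ℕ}

/-- A phase on the other registers does not help the player `i`. -/
theorem sum_expectation_tensor_le {O : Type*} [Fintype O]
    {M : (i : ι) → O → Matrix (α i) (α i) ℂ} (hM : ∀ i, IsPOVM (M i)) (i : ι)
    (h : O → ((i : ι) → α i) → ℂ)
    (hh : ∀ x a b, (∀ k, k ≠ i → a k = b k) → star (h x a) * h x b = 1)
    (w : ((i : ι) → α i) → ℂ) :
    ∑ x, expectation (tensor fun k => M k x) (fun a => h x a * w a) ≤ ∑ a, ‖w a‖ ^ 2 := by
  calc ∑ x, expectation (tensor fun k => M k x) (fun a => h x a * w a)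
      ≤ ∑ x, expectation (onFactor i (M i x)) (fun a => h x a * w a) :=
        Finset.sum_le_sum fun x _ => expectation_tensor_le hM x i _
    _ = ∑ x, expectation (onFactor i (M i x)) w := by
        refine Finset.sum_congr rfl fun x _ => ?_
        rw [expectation_eq_sum, expectation_eq_sum]
        congr 1
        refine Finset.sum_congr rfl fun a _ => Finset.sum_congr rfl fun b _ => ?_
        -- `onFactor` couples only basis states that agree away from `i`, and for these the phases
        -- cancel by `hh`.
        rw [onFactor_apply]
        split_ifs with hab
        · rw [star_mul']
          linear_combination (star (w a) * M i x (a i) (b i) * w b) * hh x a b hab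
        · simp
    _ = ∑ a, ‖w a‖ ^ 2 := by
        rw [← expectation_sum, sum_onFactor i (hM i).sum_eq_one, expectation_one]

theorem innerSign_prod_mul_self {κ : Type*} (s : Finset κ) (x : Bits n) (u : κ → Bits n) :
    (∏ k ∈ s, innerSign x (u k)) * ∏ k ∈ s, innerSign x (u k) = 1 := by
  rw [← Finset.prod_mul_distrib]
  exact Finset.prod_eq_one fun k _ => innerSign_mul_self _ _

theorem star_innerSign_prod {κ : Type*} (s : Finset κ) (x : Bits n) (u : κ → Bits n) :
    star (∏ k ∈ s, innerSign x (u k)) = ∏ k ∈ s, innerSign x (u k) := by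
  rw [star_prod]
  exact Finset.prod_congr rfl fun k _ => star_innerSign _ _

/-- The vector is cut into pieces on each of which one player's register carries no sign depending
on `x`, so that `sum_expectation_tensor_le` applies. The factor is the Cauchy–Schwarz cost of the
indices `(i, y)` with `y ∈ T` and `(i, k)`. -/
theorem sum_expectation_tensor_innerSign_le (l : (i : ι) → α i → Bits n)
    {M : (i : ι) → Bits n → Matrix (α i) (α i) ℂ} (hM : ∀ i, IsPOVM (M i))
    (T : Finset (Bits n)) (w : ((i : ι) → α i) → ℂ)
    (hw : ∀ a, w a ≠ 0 → ∃ i, l i (a i) ∈ T ∨ ∃ k, k ≠ i ∧ l k (a k) = l i (a i)) :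
    ∑ x, expectation (tensor fun i => M i x) (fun a => (∏ i, innerSign x (l i (a i))) * w a) ≤
      (Fintype.card ι * (T.card + Fintype.card ι) : ℕ) * ∑ a, ‖w a‖ ^ 2 := by
  classical
  let good : ι × (T ⊕ ι) → ((i : ι) → α i) → Prop := fun r a =>
    Sum.elim (fun y : T => l r.1 (a r.1) = y) (fun k => k ≠ r.1 ∧ l k (a k) = l r.1 (a r.1)) r.2
  -- One reason is chosen for each basis state, so the pieces have disjoint supports and their
  -- squared norms add up; `none` occurs only where `w` vanishes.
  have hgood : ∀ a, ∃ o : Option (ι × (T ⊕ ι)), (w a ≠ 0 → ∃ r, o = some r) ∧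
      ∀ r, o = some r → good r a := by
    intro a
    by_cases h0 : w a = 0
    · exact ⟨none, by simp [h0], by simp⟩
    · obtain ⟨i, hi | ⟨k, hk⟩⟩ := hw a h0
      · exact ⟨some (i, Sum.inl ⟨_, hi⟩), by simp, by simp [good]⟩
      · refine ⟨some (i, Sum.inr k), by simp, ?_⟩
        rintro r hr
        obtain rfl := Option.some_injective _ hr
        exact hk
  choose c hc1 hc2 using hgood
  let v : ι × (T ⊕ ι) → ((i : ι) → α i) → ℂ := fun r a => if c a = some r then w a else 0
  have hsum : ∀ a, ∑ r, v r a = w a := by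
    intro a
    by_cases h0 : w a = 0
    · simp [v, h0]
    · obtain ⟨r, hr⟩ := hc1 a h0
      simp [v, hr]
  have hnorm : ∑ r, ∑ a, ‖v r a‖ ^ 2 ≤ ∑ a, ‖w a‖ ^ 2 := by
    rw [Finset.sum_comm]
    refine Finset.sum_le_sum fun a _ => ?_
    rcases hca : c a with _ | r
    · simp only [v, hca]
      simp
    · simp [v, hca, apply_ite]
  have hpiece : ∀ r, ∑ x, expectation (tensor fun i => M i x)
      (fun a => (∏ i, innerSign x (l i (a i))) * v r a) ≤ ∑ a, ‖v r a‖ ^ 2 := by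
    rintro ⟨i, y | k⟩
    -- On this piece the sign of player `i` is the constant `innerSign x y`.
    · have heq : ∀ x : Bits n, (fun a => (∏ i, innerSign x (l i (a i))) * v (i, Sum.inl y) a) =
          fun a => (innerSign x y * ∏ k ∈ Finset.univ.erase i, innerSign x (l k (a k))) *
            v (i, Sum.inl y) a := by
        intro x
        funext a
        by_cases ha : c a = some (i, Sum.inl y)
        · have hg : l i (a i) = y := hc2 a _ ha
          rw [← Finset.mul_prod_erase _ _ (Finset.mem_univ i), hg]
        · simp [v, ha]
      simp_rw [heq]
      refine sum_expectation_tensor_le hM i _ (fun x a b hab => ?_) _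
      have hp : ∏ k ∈ Finset.univ.erase i, innerSign x (l k (a k)) =
          ∏ k ∈ Finset.univ.erase i, innerSign x (l k (b k)) :=
        Finset.prod_congr rfl fun k hk => by rw [hab k (Finset.ne_of_mem_erase hk)]
      rw [star_mul', star_innerSign, star_innerSign_prod, hp, mul_mul_mul_comm,
        innerSign_mul_self, innerSign_prod_mul_self, one_mul]
    -- On this piece the equal signs of players `i` and `k` cancel, so `a i` no longer enters the
    -- product.
    · have heq : ∀ x : Bits n, (fun a => (∏ i, innerSign x (l i (a i))) * v (i, Sum.inr k) a) =
          fun a => (∏ j ∈ (Finset.univ.erase i).erase k, innerSign x (l j (a j))) *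
            v (i, Sum.inr k) a := by
        intro x
        funext a
        by_cases ha : c a = some (i, Sum.inr k)
        · have hg : k ≠ i ∧ l k (a k) = l i (a i) := hc2 a _ ha
          rw [← Finset.mul_prod_erase _ _ (Finset.mem_univ i),
            ← Finset.mul_prod_erase _ _ (Finset.mem_erase.mpr ⟨hg.1, Finset.mem_univ k⟩), hg.2,
            ← mul_assoc, innerSign_mul_self, one_mul]
        · simp [v, ha]
      simp_rw [heq]
      refine sum_expectation_tensor_le hM i _ (fun x a b hab => ?_) _
      have hp : ∏ j ∈ (Finset.univ.erase i).erase k, innerSign x (l j (a j)) =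
          ∏ j ∈ (Finset.univ.erase i).erase k, innerSign x (l j (b j)) :=
        Finset.prod_congr rfl fun j hj => by
          rw [hab j (Finset.ne_of_mem_erase (Finset.mem_of_mem_erase hj))]
      rw [star_innerSign_prod, hp, innerSign_prod_mul_self]
  have hcard : Fintype.card (ι × (T ⊕ ι)) = Fintype.card ι * (T.card + Fintype.card ι) := by
    simp
  calc ∑ x, expectation (tensor fun i => M i x) (fun a => (∏ i, innerSign x (l i (a i))) * w a)
      ≤ ∑ x, (Fintype.card (ι × (T ⊕ ι)) : ℝ) * ∑ r, expectation (tensor fun i => M i x)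
          (fun a => (∏ i, innerSign x (l i (a i))) * v r a) := by
        refine Finset.sum_le_sum fun x _ => ?_
        refine le_trans (le_of_eq ?_) (expectation_sum_le
          (posSemidef_tensor fun i => (hM i).posSemidef x) _)
        congr 1
        funext a
        rw [Finset.sum_apply, ← Finset.mul_sum, hsum]
    _ = (Fintype.card ι * (T.card + Fintype.card ι) : ℕ) * ∑ r, ∑ x,
          expectation (tensor fun i => M i x)
            (fun a => (∏ i, innerSign x (l i (a i))) * v r a) := by
        rw [← Finset.mul_sum, Finset.sum_comm, hcard]
    _ ≤ (Fintype.card ι * (T.card + Fintype.card ι) : ℕ) * ∑ a, ‖w a‖ ^ 2 := by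
        gcongr
        exact (Finset.sum_le_sum fun r _ => hpiece r).trans hnorm

variable {Θ : Type*} [Fintype Θ] [Nonempty Θ] {σ : Type*} [Fintype σ] [DecidableEq σ] {J : Type*}
  [Fintype J]

/-- The joint state before the measurement when the oracle phase `f` has been applied to each
player's register and the amplitudes `c` to the states with phases `f(u) ⊕ ⟨x, u⟩`. -/
noncomputable def phaseState (l : (i : ι) → α i → Bits n) (f : Bits n → Bool) (x : Bits n)
    (c : ((i : ι) → α i) → (σ → Bits n) → ℂ) : ((i : ι) → α i) → ℂ :=
  fun a => ∑ u, (∏ i, sign (f (l i (a i)))) * (∏ s, sign (f (u s)) * innerSign x (u s)) * c a u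

/-- The part of the amplitudes `c` in which the phases multiply to the character of `T`. -/
noncomputable def walshComponent (l : (i : ι) → α i → Bits n)
    (c : ((i : ι) → α i) → (σ → Bits n) → ℂ) (T : Finset (Bits n)) : ((i : ι) → α i) → ℂ :=
  fun a => ∑ u, if oddSupport (Sum.elim (fun i => l i (a i)) u) = T then c a u else 0

omit [DecidableEq ι] [∀ i, Fintype (α i)] [∀ i, DecidableEq (α i)] in
-- Both `sign ∘ f` and `innerSign x` square to 1, so each multiplies along `(l(a), u)` to a product
-- over the same odd support `T`. Solving the second identity for the product over `u` leaves a sign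
-- depending on `T` alone and local signs on the players.
theorem phaseState_eq_sum (l : (i : ι) → α i → Bits n) (f : Bits n → Bool) (x : Bits n)
    (c : ((i : ι) → α i) → (σ → Bits n) → ℂ) :
    phaseState l f x c = ∑ T, walsh T f • ((∏ y ∈ T, innerSign x y) •
      fun a => (∏ i, innerSign x (l i (a i))) * walshComponent l c T a) := by
  funext a
  simp only [Finset.sum_apply, Pi.smul_apply, smul_eq_mul, walshComponent, phaseState,
    Finset.mul_sum]
  rw [Finset.sum_comm]
  refine Finset.sum_congr rfl fun u _ => ?_
  simp only [mul_ite, mul_zero, Finset.sum_ite_eq, Finset.mem_univ, if_true]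
  have h1 := prod_comp_eq_prod_oddSupport (Sum.elim (fun i => l i (a i)) u)
    (g := fun y => sign (f y)) fun y => sign_mul_self _
  have h2 := prod_comp_eq_prod_oddSupport (Sum.elim (fun i => l i (a i)) u)
    (g := fun y => innerSign x y) fun y => innerSign_mul_self _ _
  rw [Fintype.prod_sum_type] at h1 h2
  simp only [Sum.elim_inl, Sum.elim_inr] at h1 h2
  rw [walsh, ← h1, ← h2, Finset.prod_mul_distrib]
  have h3 := innerSign_prod_mul_self Finset.univ x fun i => l i (a i)
  linear_combination (-(∏ i, sign (f (l i (a i)))) * (∏ s, sign (f (u s))) *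
    (∏ s, innerSign x (u s)) * c a u) * h3

/-- After averaging over `θ`, the components `T` are bounded one by one with the same constant, and
their squared norms sum to 1. -/
theorem sum_expectation_phaseState_le (hcard : Fintype.card σ < Fintype.card ι)
    (l : (i : ι) → α i → Bits n)
    {M : (i : ι) → Bits n → Matrix (α i) (α i) ℂ} (hM : ∀ i, IsPOVM (M i))
    {f : Θ → Bits n → Bool} (hf : IsWiseUniform (2 * (Fintype.card ι + Fintype.card σ)) f)
    (c : J → ((i : ι) → α i) → (σ → Bits n) → ℂ)
    (hc : ∀ θ x, ∑ j, ∑ a, ‖phaseState l (f θ) x (c j) a‖ ^ 2 = 1) :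
    ∑ θ, ∑ x, ∑ j, expectation (tensor fun i => M i x) (phaseState l (f θ) x (c j)) ≤
      Fintype.card Θ *
        (Fintype.card ι * (2 * Fintype.card ι + Fintype.card σ) : ℕ) := by
  set m := Fintype.card ι + Fintype.card σ with hm
  set K := Fintype.card ι * (2 * Fintype.card ι + Fintype.card σ) with hK
  let w : J → Finset (Bits n) → ((i : ι) → α i) → ℂ := fun j T => walshComponent l (c j) T
  let v : Bits n → J → Finset (Bits n) → ((i : ι) → α i) → ℂ := fun x j T =>
    (∏ y ∈ T, innerSign x y) • fun a => (∏ i, innerSign x (l i (a i))) * w j T a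
  have hw0 : ∀ j T a, w j T a ≠ 0 →
      ∃ u : σ → Bits n, oddSupport (Sum.elim (fun i => l i (a i)) u) = T := by
    intro j T a h
    by_contra! hne
    exact h (Finset.sum_eq_zero fun u _ => if_neg (hne u))
  have hwT : ∀ j T, m < T.card → w j T = 0 := by
    intro j T hT
    funext a
    by_contra h
    obtain ⟨u, rfl⟩ := hw0 j T a h
    have := card_oddSupport_le (Sum.elim (fun i => l i (a i)) u)
    rw [Fintype.card_sum] at this
    omega
  have hvT : ∀ x j T, m < T.card → v x j T = 0 := by
    intro x j T hT
    funext a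
    simp [v, hwT j T hT]
  have hphase : ∀ (x : Bits n) (T : Finset (Bits n)),
      star (∏ y ∈ T, innerSign x y) * ∏ y ∈ T, innerSign x y = 1 := by
    intro x T
    exact (congrArg (· * _) (star_innerSign_prod T x id)).trans (innerSign_prod_mul_self T x id)
  have hav : ∀ (N : Matrix ((i : ι) → α i) ((i : ι) → α i) ℂ) (x : Bits n) (j : J),
      ∑ θ, expectation N (phaseState l (f θ) x (c j)) =
        Fintype.card Θ * ∑ T, expectation N (v x j T) := by
    intro N x j
    simp_rw [phaseState_eq_sum]
    exact hf.sum_expectation N (v x j) (hvT x j)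
  have hΘ : (Fintype.card Θ : ℝ) ≠ 0 := Nat.cast_ne_zero.mpr Fintype.card_ne_zero
  -- The averaging identity for the identity operator, at one arbitrary `x`, computes the total
  -- squared norm of the components.
  have hone : ∑ j, ∑ T, ∑ a, ‖w j T a‖ ^ 2 = 1 := by
    have h1 : ∑ j, ∑ θ, expectation 1 (phaseState l (f θ) (fun _ => false) (c j)) =
        Fintype.card Θ := by
      rw [Finset.sum_comm]
      simp [expectation_one, hc]
    simp_rw [hav] at h1
    rw [← Finset.mul_sum, mul_eq_left₀ hΘ] at h1
    rw [← h1]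
    refine Finset.sum_congr rfl fun j _ => Finset.sum_congr rfl fun T _ => ?_
    rw [expectation_smul _ (hphase _ T), expectation_one]
    refine Finset.sum_congr rfl fun a _ => ?_
    rw [norm_mul, mul_pow, pow_two ‖∏ i, _‖, ← norm_mul, innerSign_prod_mul_self, norm_one, one_mul]
  have hT : ∀ j T, ∑ x, expectation (tensor fun i => M i x) (v x j T) ≤
      K * ∑ a, ‖w j T a‖ ^ 2 := by
    intro j T
    by_cases hTm : m < T.card
    · simp [hvT _ j T hTm, hwT j T hTm, expectation]
    · simp_rw [v, expectation_smul _ (hphase _ T)]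
      refine (sum_expectation_tensor_innerSign_le l hM T (w j T) ?_).trans ?_
      · intro a ha
        obtain ⟨u, rfl⟩ := hw0 j T a ha
        exact exists_mem_oddSupport_or_eq _ u hcard
      · refine mul_le_mul_of_nonneg_right ?_ (Finset.sum_nonneg fun a _ => by positivity)
        rw [Nat.cast_le, hK]
        -- Here `T.card ≤ m`, the number of players plus the number of copies.
        exact Nat.mul_le_mul_left _ (by omega)
  calc ∑ θ, ∑ x, ∑ j, expectation (tensor fun i => M i x) (phaseState l (f θ) x (c j))
      = Fintype.card Θ * ∑ j, ∑ T, ∑ x, expectation (tensor fun i => M i x) (v x j T) := by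
        rw [Finset.sum_comm]
        simp_rw [Finset.sum_comm (s := (Finset.univ : Finset Θ)), hav, ← Finset.mul_sum]
        congr 1
        rw [Finset.sum_comm]
        exact Finset.sum_congr rfl fun j _ => Finset.sum_comm
    _ ≤ Fintype.card Θ * ∑ j, ∑ T, K * ∑ a, ‖w j T a‖ ^ 2 := by
        gcongr
        exact hT _ _
    _ = Fintype.card Θ * K := by
        simp_rw [← Finset.mul_sum]
        rw [hone, mul_one]

end Players

/-! ### Dilation of an instrument to an isometry -/

section Stack

variable {o p d : Type*} [Fintype o] [DecidableEq o] [Fintype p]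

/-- The matrix whose blocks of rows are the matrices `V k`. -/
def stack (V : o → Matrix p d ℂ) : Matrix (p × o) d ℂ :=
  Matrix.of fun a b => V a.2 a.1 b

theorem stack_conjTranspose_mul_blockDiagonal_mul [DecidableEq p] (V : o → Matrix p d ℂ)
    (M : o → Matrix p p ℂ) :
    (stack V)ᴴ * Matrix.blockDiagonal M * stack V = ∑ k, (V k)ᴴ * M k * V k := by
  ext b b'
  simp only [Matrix.mul_apply, Matrix.sum_apply, stack, Matrix.of_apply,
    Matrix.conjTranspose_apply, Matrix.blockDiagonal_apply, Fintype.sum_prod_type, mul_ite,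
    mul_zero, Finset.sum_ite_eq', Finset.mem_univ, if_true]
  exact Finset.sum_comm

theorem stack_conjTranspose_mul_self [DecidableEq p] (V : o → Matrix p d ℂ) :
    (stack V)ᴴ * stack V = ∑ k, (V k)ᴴ * V k := by
  have h := stack_conjTranspose_mul_blockDiagonal_mul V fun _ => 1
  simpa [show (fun _ : o => (1 : Matrix p p ℂ)) = 1 from rfl] using h

theorem diagonal_mul_stack [DecidableEq p] (D : p × o → ℂ) (V : o → Matrix p d ℂ) :
    Matrix.diagonal D * stack V = stack fun k => Matrix.diagonal (fun a => D (a, k)) * V k := by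
  ext a b
  simp [stack, Matrix.diagonal_mul]

end Stack

theorem IsPOVM.conj {O α : Type*} [Fintype O] [Fintype α] [DecidableEq α]
    {M : O → Matrix α α ℂ} (hM : IsPOVM M) {W : Matrix α α ℂ} (hW : Wᴴ * W = 1) :
    IsPOVM fun x => Wᴴ * M x * W where
  posSemidef x := (hM.posSemidef x).conjTranspose_mul_mul_same W
  sum_eq_one := by rw [← Finset.sum_mul, ← Finset.mul_sum, hM.sum_eq_one, Matrix.mul_one, hW]

theorem isPOVM_blockDiagonal {O o p : Type*} [Fintype O] [Fintype o] [DecidableEq o] [Fintype p]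
    [DecidableEq p] {M : o → O → Matrix p p ℂ} (hM : ∀ k, IsPOVM (M k)) :
    IsPOVM fun x => Matrix.blockDiagonal fun k => M k x where
  posSemidef x := posSemidef_blockDiagonal fun k => (hM k).posSemidef x
  sum_eq_one := by
    ext a b
    simp only [Matrix.sum_apply, Matrix.blockDiagonal_apply]
    have h : ∑ x, M a.2 x a.1 b.1 = (1 : Matrix p p ℂ) a.1 b.1 := by
      rw [← (hM a.2).sum_eq_one, Matrix.sum_apply]
    by_cases h2 : a.2 = b.2
    · simp [h2, h2 ▸ h, Matrix.one_apply, Prod.ext_iff]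
    · rw [Matrix.one_apply_ne fun hab => h2 (congrArg Prod.snd hab)]
      simp [h2]

/-- The oracle phases `(-1)^{f(l(a))}` as a diagonal operator. -/
def phaseQuery {n : ℕ} {α : Type*} [DecidableEq α] (l : α → Bits n) (f : Bits n → Bool) :
    Matrix α α ℂ :=
  Matrix.diagonal fun a => sign (f (l a))

theorem phaseQuery_conjTranspose {n : ℕ} {α : Type*} [DecidableEq α] (l : α → Bits n)
    (f : Bits n → Bool) : (phaseQuery l f)ᴴ = phaseQuery l f := by
  rw [phaseQuery, Matrix.diagonal_conjTranspose]
  exact congrArg _ (funext fun a => star_sign _)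

theorem phaseQuery_mul_self {n : ℕ} {α : Type*} [Fintype α] [DecidableEq α] (l : α → Bits n)
    (f : Bits n → Bool) : phaseQuery l f * phaseQuery l f = 1 := by
  rw [phaseQuery, Matrix.diagonal_mul_diagonal, ← Matrix.diagonal_one]
  exact congrArg _ (funext fun a => sign_mul_self _)

theorem tensorMap_phaseQuery_mul {n : ℕ} {ι : Type*} [Fintype ι] {α β : ι → Type*}
    [∀ i, Fintype (α i)] [∀ i, DecidableEq (α i)] [Fintype ((i : ι) → α i)]
    [DecidableEq ((i : ι) → α i)] (l : (i : ι) → α i → Bits n) (f : Bits n → Bool)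
    (V : (i : ι) → Matrix (α i) (β i) ℂ) :
    tensorMap (fun i => phaseQuery (l i) f * V i) =
      (Matrix.diagonal (fun a : (i : ι) → α i => ∏ i, sign (f (l i (a i)))) :
        Matrix ((i : ι) → α i) ((i : ι) → α i) ℂ) * tensorMap V := by
  ext a b
  rw [Matrix.diagonal_mul]
  simp [tensorMap, phaseQuery, Finset.prod_mul_distrib]

/-! ### Reduction of arbitrary queries to phase queries -/

section Players

variable {n d r : ℕ}

theorem phaseOracle_kronecker_one (f : Bits n → Bool) :
    phaseOracle f ⊗ₖ (1 : Matrix (Fin r) (Fin r) ℂ) =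
      phaseQuery (fun a : Bits n × Fin r => a.1) f := by
  rw [phaseOracle, ← Matrix.diagonal_one, Matrix.diagonal_kronecker_diagonal, phaseQuery]
  simp

theorem hadamard_kronecker_one_unitary :
    (hadamard n ⊗ₖ (1 : Matrix (Fin r) (Fin r) ℂ))ᴴ * (hadamard n ⊗ₖ 1) = 1 ∧
      (hadamard n ⊗ₖ (1 : Matrix (Fin r) (Fin r) ℂ)) * (hadamard n ⊗ₖ 1)ᴴ = 1 := by
  have h1 := Matrix.mem_unitaryGroup_iff.mp (hadamard_mem n)
  have h2 := Matrix.mem_unitaryGroup_iff'.mp (hadamard_mem n)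
  rw [Matrix.star_eq_conjTranspose] at h1 h2
  constructor
  · rw [Matrix.conjTranspose_kronecker, ← Matrix.mul_kronecker_mul, h2]
    simp
  · rw [Matrix.conjTranspose_kronecker, ← Matrix.mul_kronecker_mul, h1]
    simp

/-- Since `U_f H` and its inverse differ from the phase oracle by a fixed unitary, every query is a
query to the phase oracle. -/
theorem exists_phaseQuery_branch (q : Query) (K : Matrix (Bits n × Fin r) (Fin d) ℂ)
    {M : Bits n → Matrix (Bits n × Fin r) (Bits n × Fin r) ℂ} (hM : IsPOVM M) :
    ∃ (V : Matrix (Bits n × Fin r) (Fin d) ℂ) (l : Bits n × Fin r → Bits n)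
      (N : Bits n → Matrix (Bits n × Fin r) (Bits n × Fin r) ℂ),
      Vᴴ * V = Kᴴ * K ∧ IsPOVM N ∧ ∀ f x,
        ((q.op (binaryPhaseUnitary f) ⊗ₖ (1 : Matrix (Fin r) (Fin r) ℂ)) * K)ᴴ * M x *
          ((q.op (binaryPhaseUnitary f) ⊗ₖ (1 : Matrix (Fin r) (Fin r) ℂ)) * K) =
        (phaseQuery l f * V)ᴴ * N x * (phaseQuery l f * V) := by
  obtain ⟨hH1, hH2⟩ := hadamard_kronecker_one_unitary (n := n) (r := r)
  set H := hadamard n ⊗ₖ (1 : Matrix (Fin r) (Fin r) ℂ) with hH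
  have hU : ∀ f : Bits n → Bool, ((binaryPhaseUnitary f : Matrix.unitaryGroup (Bits n) ℂ) :
      Matrix (Bits n) (Bits n) ℂ) ⊗ₖ (1 : Matrix (Fin r) (Fin r) ℂ) =
        phaseQuery (fun a => a.1) f * H := by
    intro f
    rw [← phaseOracle_kronecker_one, hH, ← Matrix.mul_kronecker_mul, Matrix.mul_one]
    rfl
  cases q with
  | none =>
    -- Without a query, a constant label is used: it yields a global sign, which cancels in the
    -- effect.
    refine ⟨K, fun _ _ => false, M, rfl, hM, fun f x => ?_⟩
    have h : phaseQuery (fun _ : Bits n × Fin r => fun _ => false) f =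
        sign (f fun _ => false) • (1 : Matrix (Bits n × Fin r) (Bits n × Fin r) ℂ) := by
      rw [phaseQuery, Matrix.smul_one_eq_diagonal]
    rw [h]
    simp only [Query.op, Matrix.one_kronecker_one, Matrix.one_mul, Matrix.smul_mul,
      Matrix.conjTranspose_smul, Matrix.mul_smul, smul_smul, star_sign, sign_mul_self, one_smul]
  | forward =>
    refine ⟨H * K, fun a => a.1, M, ?_, hM, fun f x => ?_⟩
    · rw [Matrix.conjTranspose_mul, Matrix.mul_assoc, ← Matrix.mul_assoc Hᴴ, hH1, Matrix.one_mul]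
    · rw [Query.op, hU, Matrix.mul_assoc (phaseQuery _ f)]
  | inverse =>
    -- The inverse is `Hᴴ` after the phase oracle, so `Hᴴ` is absorbed into the measurement.
    refine ⟨K, fun a => a.1, fun x => Hᴴᴴ * M x * Hᴴ, rfl, hM.conj ?_, fun f x => ?_⟩
    · rw [Matrix.conjTranspose_conjTranspose, hH2]
    · have h : (Query.inverse.op (binaryPhaseUnitary f)) ⊗ₖ (1 : Matrix (Fin r) (Fin r) ℂ) =
          Hᴴ * phaseQuery (fun a => a.1) f := by
        rw [Query.op, ← phaseQuery_conjTranspose, ← Matrix.conjTranspose_mul, ← hU,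
          Matrix.conjTranspose_kronecker, Matrix.conjTranspose_one]
      rw [h]
      simp only [Matrix.conjTranspose_mul, Matrix.mul_assoc]

/-- The classical outcome is kept as an extra register: the Kraus operators stack to an isometry,
the measurement becomes block diagonal, and the label may depend on the outcome. -/
theorem OneQueryAlgorithm.exists_phaseQuery (A : OneQueryAlgorithm n d) :
    ∃ (V : Matrix ((Bits n × Fin A.ancillaDim) × Fin A.numOutcomes) (Fin d) ℂ)
      (l : (Bits n × Fin A.ancillaDim) × Fin A.numOutcomes → Bits n)
      (M : Bits n → Matrix ((Bits n × Fin A.ancillaDim) × Fin A.numOutcomes)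
        ((Bits n × Fin A.ancillaDim) × Fin A.numOutcomes) ℂ),
      Vᴴ * V = 1 ∧ IsPOVM M ∧ ∀ f x, A.effect (binaryPhaseUnitary f) x =
        (phaseQuery l f * V)ᴴ * M x * (phaseQuery l f * V) := by
  choose V l M hV hM h using fun k =>
    exists_phaseQuery_branch (A.query k) (A.kraus k) (A.isPOVM_measure k)
  refine ⟨stack V, fun a => l a.2 a.1, fun x => Matrix.blockDiagonal fun k => M k x, ?_,
    isPOVM_blockDiagonal hM, fun f x => ?_⟩
  · rw [stack_conjTranspose_mul_self, ← A.kraus_complete]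
    exact Finset.sum_congr rfl fun k _ => hV k
  · rw [phaseQuery, diagonal_mul_stack, stack_conjTranspose_mul_blockDiagonal_mul,
      OneQueryAlgorithm.effect]
    exact Finset.sum_congr rfl fun k _ => h k f x

end Players

/-! ### Kraus operators of the cloner and the state of the copies -/

section Channel

/-- A completely positive map has a Kraus decomposition (stated for pure states). -/
theorem IsCPTP.exists_kraus {α β : Type*} [Fintype α] [Fintype β]
    {Φ : Matrix α α ℂ →ₗ[ℂ] Matrix β β ℂ} (hΦ : IsCPTP Φ) :
    ∃ L : Fin (Fintype.card α) × β → Matrix β α ℂ, ∀ v : α → ℂ,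
      Φ (Matrix.vecMulVec v (star v)) =
        ∑ j, Matrix.vecMulVec (L j *ᵥ v) (star (L j *ᵥ v)) := by
  classical
  let e := Fintype.equivFin α
  -- The unnormalized maximally entangled vector; the ampliation sends its projector to the Choi
  -- matrix, whose factor `B` contains the Kraus operators.
  let ω : Fin (Fintype.card α) × α → ℂ := fun p => if e p.2 = p.1 then 1 else 0
  obtain ⟨B, hB⟩ := exists_eq_conjTranspose_mul_self
    (hΦ.completelyPositive _ _ (Matrix.posSemidef_vecMulVec_self_star ω))
  have hΦB : ∀ a a' b b', Φ (Matrix.single a a' 1) b b' =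
      ∑ j, star (B j (e a, b)) * B j (e a', b') := by
    intro a a' b b'
    have h := congrFun (congrFun hB (e a, b)) (e a', b')
    simp only [ampliation, Matrix.of_apply, Matrix.mul_apply, Matrix.conjTranspose_apply] at h
    have hω : Matrix.single a a' 1 =
        Matrix.of fun c c' => Matrix.vecMulVec ω (star ω) (e a, c) (e a', c') := by
      ext c c'
      by_cases hc : a = c <;> by_cases hc' : a' = c' <;>
        simp [ω, Matrix.vecMulVec_apply, hc, hc', eq_comm]
    rw [← h, hω]
  refine ⟨fun j => Matrix.of fun b a => star (B j (e a, b)), fun v => ?_⟩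
  ext b b'
  have hv : Matrix.vecMulVec v (star v) =
      ∑ a, ∑ a', (v a * star (v a')) • Matrix.single a a' (1 : ℂ) := by
    rw [Matrix.matrix_eq_sum_single (Matrix.vecMulVec v (star v))]
    simp [Matrix.vecMulVec_apply]
  rw [hv]
  simp only [map_sum, map_smul, Matrix.sum_apply, Matrix.smul_apply, hΦB, Matrix.vecMulVec_apply,
    Pi.star_apply, smul_eq_mul, Matrix.mulVec, dotProduct, Matrix.of_apply, star_sum, star_mul',
    star_star, Finset.mul_sum, Finset.sum_mul]
  rw [Finset.sum_comm]
  simp_rw [Finset.sum_comm (t := (Finset.univ : Finset (Fin (Fintype.card α) × β)))]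
  refine Finset.sum_congr rfl fun j _ => ?_
  refine Finset.sum_congr rfl fun a' _ => Finset.sum_congr rfl fun a _ => ?_
  ring

theorem trace_vecMulVec_star {α : Type*} [Fintype α] (v : α → ℂ) :
    (Matrix.vecMulVec v (star v)).trace.re = ∑ a, ‖v a‖ ^ 2 := by
  classical
  rw [← expectation_one, ← trace_mul_vecMulVec, Matrix.one_mul]

/-- The vector `(U|x⟩)^{⊗ t}`. -/
noncomputable def cipherVector {n : ℕ} (t : ℕ) (U : Matrix.unitaryGroup (Bits n) ℂ) (x : Bits n) :
    (Fin t → Bits n) → ℂ :=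
  fun u => ∏ s, (U : Matrix (Bits n) (Bits n) ℂ) (u s) x

theorem cipherState_apply {n : ℕ} (U : Matrix.unitaryGroup (Bits n) ℂ) (x a b : Bits n) :
    cipherState U x a b = (U : Matrix (Bits n) (Bits n) ℂ) a x *
      star ((U : Matrix (Bits n) (Bits n) ℂ) b x) := by
  simp [cipherState, Matrix.mul_apply, Matrix.single_apply, ite_and]

theorem tensor_cipherState {n t : ℕ} (U : Matrix.unitaryGroup (Bits n) ℂ) (x : Bits n) :
    tensor (fun _ : Fin t => cipherState U x) =
      Matrix.vecMulVec (cipherVector t U x) (star (cipherVector t U x)) := by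
  ext u u'
  simp [tensor, cipherState_apply, cipherVector, Matrix.vecMulVec_apply, Finset.prod_mul_distrib]

theorem sum_norm_cipherVector {n t : ℕ} (U : Matrix.unitaryGroup (Bits n) ℂ) (x : Bits n) :
    ∑ u, ‖cipherVector t U x u‖ ^ 2 = 1 := by
  have h : (cipherState U x).trace = 1 := by
    rw [cipherState, Matrix.trace_mul_comm, ← Matrix.mul_assoc, ← Matrix.star_eq_conjTranspose,
      Matrix.mem_unitaryGroup_iff'.mp U.2, Matrix.one_mul, Matrix.trace_single_eq_same]
  rw [← trace_vecMulVec_star, ← tensor_cipherState, Matrix.trace]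
  simp only [Matrix.diag_apply, tensor, Matrix.of_apply]
  rw [← Fintype.prod_sum fun (_ : Fin t) a => cipherState U x a a]
  simp only [Matrix.trace, Matrix.diag_apply] at h
  simp [h]

end Channel

/-! ### The bound on the winning probability -/

theorem cipherVector_binaryPhaseUnitary {n t : ℕ} (f : Bits n → Bool) (x : Bits n)
    (u : Fin t → Bits n) :
    cipherVector t (binaryPhaseUnitary f) x u =
      (((Real.sqrt 2 : ℝ) : ℂ)⁻¹ ^ n) ^ t * ∏ s, (sign (f (u s)) * innerSign x (u s)) := by
  have h : ∀ y, (binaryPhaseUnitary f : Matrix (Bits n) (Bits n) ℂ) y x =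
      (((Real.sqrt 2 : ℝ) : ℂ)⁻¹ ^ n) * (sign (f y) * innerSign x y) := by
    intro y
    have : (binaryPhaseUnitary f : Matrix (Bits n) (Bits n) ℂ) = phaseOracle f * hadamard n := rfl
    rw [this, phaseOracle, Matrix.diagonal_mul, hadamard, Matrix.of_apply, innerSign_comm]
    ring
  simp only [cipherVector, h]
  rw [Finset.prod_mul_distrib, Finset.prod_const, Finset.card_univ, Fintype.card_fin]

theorem winProb_le {n t : ℕ} {Θ : Type*} [Fintype Θ] [Nonempty Θ] {f : Θ → Bits n → Bool}
    (hf : IsWiseUniform (4 * t + 2) f) (S : RestrictedStrategy n t) :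
    winProb (fun θ => binaryPhaseUnitary (f θ)) S ≤
      ((t + 1) * (3 * t + 2) : ℕ) * (2 : ℝ)⁻¹ ^ n := by
  choose V l M hV hM hP using fun i => (S.player i).exists_phaseQuery
  obtain ⟨L, hL⟩ := S.isCPTP_channel.exists_kraus
  let G : (Bits n → Bool) → (i : Fin (t + 1)) → Matrix _ (Fin (S.dim i)) ℂ :=
    fun g i => phaseQuery (l i) g * V i
  -- The amplitudes collect all that depends on neither `θ` nor `x`: the normalization, the players'
  -- isometries and the Kraus operator of the cloner.
  let c := fun j (a : (i : Fin (t + 1)) →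
      (Bits n × Fin (S.player i).ancillaDim) × Fin (S.player i).numOutcomes)
      (u : Fin t → Bits n) => (((Real.sqrt 2 : ℝ) : ℂ)⁻¹ ^ n) ^ t * (tensorMap V * L j) a u
  have hstate : ∀ g x j, tensorMap (G g) *ᵥ (L j *ᵥ cipherVector t (binaryPhaseUnitary g) x) =
      phaseState l g x (c j) := by
    intro g x j
    funext a
    rw [Matrix.mulVec_mulVec, tensorMap_phaseQuery_mul, Matrix.mul_assoc, Matrix.mulVec, dotProduct]
    refine Finset.sum_congr rfl fun u _ => ?_
    rw [Matrix.diagonal_mul, cipherVector_binaryPhaseUnitary]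
    ring
  have hwin : ∀ g x, winProbAt (binaryPhaseUnitary g) S x =
      ∑ j, expectation (tensor fun i => M i x) (phaseState l g x (c j)) := by
    intro g x
    have heff : tensor (fun i => (S.player i).effect (binaryPhaseUnitary g) x) =
        (tensorMap (G g))ᴴ * tensor (fun i => M i x) * tensorMap (G g) := by
      simp_rw [hP]
      rw [tensorMap_conjTranspose]
      change tensorMap _ = tensorMap _ * tensorMap _ * tensorMap _
      rw [tensorMap_mul, tensorMap_mul]
    rw [winProbAt, tensor_cipherState, hL, Finset.mul_sum, Matrix.trace_sum, Complex.re_sum]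
    refine Finset.sum_congr rfl fun j _ => ?_
    rw [trace_mul_vecMulVec, heff, expectation_conjTranspose_mul_mul, hstate]
  have hnorm : ∀ g x, ∑ j, ∑ a, ‖phaseState l g x (c j) a‖ ^ 2 = 1 := by
    intro g x
    have hG : (tensorMap (G g))ᴴ * tensorMap (G g) = 1 := by
      rw [tensorMap_conjTranspose, tensorMap_mul, ← tensorMap_one]
      congr 1
      funext i
      rw [Matrix.conjTranspose_mul, Matrix.mul_assoc, ← Matrix.mul_assoc _ _ (V i),
        phaseQuery_conjTranspose, phaseQuery_mul_self, Matrix.one_mul, hV]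
    simp_rw [← hstate, ← expectation_conjTranspose_mul_self, hG, expectation_one,
      ← trace_vecMulVec_star]
    rw [← Complex.re_sum, ← Matrix.trace_sum, ← hL, S.isCPTP_channel.tracePreserving,
      trace_vecMulVec_star, sum_norm_cipherVector]
  -- With `t + 1` players and `t` copies, the required uniformity is `2 * ((t + 1) + t) = 4 * t +
  -- 2`.
  have hle := sum_expectation_phaseState_le (σ := Fin t) (by simp) l hM (f := f)
    (by convert hf using 1; simp; ring) c fun θ x => hnorm (f θ) x
  rw [Fintype.card_fin, Fintype.card_fin, show 2 * (t + 1) + t = 3 * t + 2 by ring] at hle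
  have hΘ : (0 : ℝ) < Fintype.card Θ := Nat.cast_pos.mpr Fintype.card_pos
  rw [winProb]
  simp_rw [hwin]
  rw [← Finset.mul_sum, mul_left_comm]
  have hN : ((Fintype.card (Bits n) : ℝ))⁻¹ = (2 : ℝ)⁻¹ ^ n := by simp
  rw [hN, mul_comm]
  refine mul_le_mul_of_nonneg_right ?_ (by positivity)
  rw [inv_mul_le_iff₀ hΘ]
  exact hle

theorem players_mul_le_exp {t : ℕ} (ht : 1 ≤ t) :
    (((t + 1) * (3 * t + 2) : ℕ) : ℝ) ≤ Real.exp (4 * (t * Real.log (t + 1))) := by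
  have ht' : (1 : ℝ) ≤ t := by exact_mod_cast ht
  have hlog : 0 ≤ Real.log (t + 1 : ℝ) := Real.log_nonneg (by linarith)
  calc (((t + 1) * (3 * t + 2) : ℕ) : ℝ) = (t + 1) * (3 * t + 2) := by push_cast; ring
    _ ≤ ((t : ℝ) + 1) ^ 4 := by
        -- This needs `t ≥ 1`; together with the factor `t + 1` it gives the fourth power, hence the
        -- constant 4.
        have h1 : (3 * t + 2 : ℝ) ≤ (t + 1) ^ 3 := by nlinarith [pow_pos (zero_lt_one.trans_le ht') 2]
        calc ((t : ℝ) + 1) * (3 * t + 2) ≤ (t + 1) * (t + 1) ^ 3 := by gcongr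
          _ = _ := by ring
    _ = Real.exp (4 * Real.log (t + 1)) := by
        rw [← Real.exp_log (show (0 : ℝ) < (t : ℝ) + 1 by linarith), ← Real.exp_nat_mul,
          Real.exp_log (by linarith)]
        norm_num
    _ ≤ Real.exp (4 * (t * Real.log (t + 1))) := by
        gcongr
        exact le_mul_of_one_le_left hlog ht'

end CloningGame

theorem mainTheorem1 :
    ∃ C : ℝ, 0 < C ∧
      ∀ (t n : ℕ), 1 ≤ t →
      ∀ (Θ : Type) [Fintype Θ] [Nonempty Θ] (f : Θ → CloningGame.Bits n → Bool),
        CloningGame.IsWiseUniform (4 * t + 2) f →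
        ∀ S : CloningGame.RestrictedStrategy n t,
          CloningGame.winProb (fun θ => CloningGame.binaryPhaseUnitary (f θ)) S ≤
            Real.exp (C * (t * Real.log (t + 1))) * (2 : ℝ)⁻¹ ^ n := by
  refine ⟨4, by norm_num, fun t n ht Θ _ _ f hf S => (CloningGame.winProb_le hf S).trans ?_⟩
  exact mul_le_mul_of_nonneg_right (CloningGame.players_mul_le_exp ht) (by positivity)
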